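/- Let $(X,\mathcal X)$ be a standard Borel space, $\mu$ a probability measure on it, and $T_1,T_2\colon X\to X$ two commuting invertible bimeasurable maps that preserve $\mu$; call $(X,\mu,T_1,T_2)$ a system. For a measure preserving transformation $S$ let $\mathcal I(S)$ be the $\sigma$-algebra of measurable sets $B$ with $S^{-1}B=B$. For a probability measure $\nu$ on a standard Borel space $Y$ and a sub-$\sigma$-algebra $\mathcal B$, the relatively independent square $\nu\times_{\mathcal B}\nu$ is the measure on $Y^2$ with $\int f_0(y_0)f_1(y_1)\,d(\nu\times_{\mathcal B}\nu)=\int \mathbb E_\nu(f_0\mid\mathcal B)\,\mathbb E_\nu(f_1\mid\mathcal B)\,d\nu$ for all bounded measurable $f_0,f_1$. Put $\mu_1=\mu\times_{\mathcal I(T_1)}\mu$ on $X^2$ and $\mu^*=\mu_1\times_{\mathcal I(T_2\times T_2)}\mu_1$ on $X^4$, and for bounded measurable $f\colon X\to\mathbb R$ put $$|||f|||_{\mu,T_1,T_2}=\Big(\int f(x_{00})f(x_{01})f(x_{10})f(x_{11})\,d\mu^*(x_{00},x_{01},x_{10},x_{11})\Big)^{1/4}.$$ The system $(X,\mu,T_1,T_2)$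 is called magic if $|||f|||_{\mu,T_1,T_2}=0$ for every bounded measurable $f\colon X\to\mathbb R$ with $\mathbb E_\mu(f\mid\mathcal I(T_1)\vee\mathcal I(T_2))=0$. Let $\mu=\int\mu_x\,d\mu(x)$ be the ergodic decomposition of $\mu$ under $T_1$ and $T_2$, that is, the disintegration of $\mu$ over $\mathcal I(T_1)\cap\mathcal I(T_2)$: the map $x\mapsto\mu_x$ is measurable with respect to this $\sigma$-algebra, and $\mathbb E_\mu(f\mid\mathcal I(T_1)\cap\mathcal I(T_2))(x)=\int f\,d\mu_x$ for $\mu$-almost every $x$, for every bounded measurable $f$. If $(X,\mu,T_1,T_2)$ is a magic system, then for $\mu$-almost every $x\in X$, $(X,\mu_x,T_1,T_2)$ is a magic system (in particular $\mu_x$ is invariant under $T_1$ and $T_2$). -/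

import Mathlib

open MeasureTheory ProbabilityTheory

/-- `(X, μ, T₁, T₂)` is a system: `μ` is a probability measure and `T₁`, `T₂` are commuting
invertible bimeasurable transformations of `X` that preserve `μ`. -/
structure IsSystem {X : Type*} [MeasurableSpace X] (μ : Measure X) (T₁ T₂ : X ≃ᵐ X) : Prop where
  isProbabilityMeasure : IsProbabilityMeasure μ
  measurePreserving_fst : MeasurePreserving T₁ μ μ
  measurePreserving_snd : MeasurePreserving T₂ μ μ
  commute : ∀ x, T₁ (T₂ x) = T₂ (T₁ x)

/-- The relatively independent square `μ ×_m μ` of `μ` over a sub-σ-algebra `m`: the average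
`∫ (μ_x × μ_x) dμ(x)`, where `x ↦ μ_x` is the disintegration of `μ` over `m`. It satisfies
`∫ f₀ ⊗ f₁ d(μ ×_m μ) = ∫ E(f₀ | m) E(f₁ | m) dμ` for bounded measurable `f₀`, `f₁`. -/
noncomputable def relSquare {X : Type*} (m : MeasurableSpace X) [mX : MeasurableSpace X]
    [StandardBorelSpace X] (μ : Measure X) [IsFiniteMeasure μ] : Measure (X × X) :=
  μ.bind fun x => (condExpKernel μ m x).prod (condExpKernel μ m x)

/-- The fibre squares depend measurably on the base point. -/
theorem measurable_condExpKernel_prod {X : Type*} (m : MeasurableSpace X) [mX : MeasurableSpace X]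
    [StandardBorelSpace X] (μ : Measure X) [IsFiniteMeasure μ] :
    Measurable fun x => (condExpKernel μ m x).prod (condExpKernel μ m x) := by
  have hmeas : Measurable fun x => condExpKernel μ m x := by
    refine Measure.measurable_of_measurable_coe _ fun s hs => ?_
    rcases isEmpty_or_nonempty X with h | h
    · exact measurable_of_empty _
    · simp_rw [condExpKernel_apply_eq_condDistrib]
      exact (Kernel.measurable_coe (mα := m ⊓ mX) _ hs).mono inf_le_right le_rfl
  let κ : Kernel X X := ⟨fun x => condExpKernel μ m x, hmeas⟩
  have hκ : IsMarkovKernel κ :=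
    ⟨fun x => inferInstanceAs (IsProbabilityMeasure (condExpKernel μ m x))⟩
  have h : (fun x => (condExpKernel μ m x).prod (condExpKernel μ m x)) = fun x => (κ ×ₖ κ) x := by
    funext x
    rw [Kernel.prod_apply]
    rfl
  rw [h]
  exact (κ ×ₖ κ).measurable

/-- The relatively independent square has the same total mass as `μ`. -/
theorem relSquare_univ {X : Type*} (m : MeasurableSpace X) [MeasurableSpace X]
    [StandardBorelSpace X] (μ : Measure X) [IsFiniteMeasure μ] :
    relSquare m μ Set.univ = μ Set.univ := by
  rw [relSquare, Measure.bind_apply MeasurableSet.univ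
    (measurable_condExpKernel_prod m μ).aemeasurable]
  simp

/-- The relatively independent square is a finite measure. -/
instance relSquare.instIsFiniteMeasure {X : Type*} (m : MeasurableSpace X) [MeasurableSpace X]
    [StandardBorelSpace X] (μ : Measure X) [IsFiniteMeasure μ] :
    IsFiniteMeasure (relSquare m μ) :=
  ⟨by rw [relSquare_univ]; exact measure_lt_top μ Set.univ⟩

/-- The box measure `μ* = μ₁ ×_{I(T₂ × T₂)} μ₁` on `X⁴`, with `μ₁ = μ ×_{I(T₁)} μ`. The point
`(x₀₀, x₀₁, x₁₀, x₁₁)` of `X⁴` is written as `((x₀₀, x₀₁), (x₁₀, x₁₁))`. -/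
noncomputable def boxMeasure {X : Type*} [MeasurableSpace X] [StandardBorelSpace X]
    (μ : Measure X) [IsFiniteMeasure μ] (T₁ T₂ : X ≃ᵐ X) : Measure ((X × X) × (X × X)) :=
  relSquare (MeasurableSpace.invariants (Prod.map T₂ T₂))
    (relSquare (MeasurableSpace.invariants T₁) μ)

/-- The box seminorm `|||f|||_{μ, T₁, T₂} = (∫ f(x₀₀) f(x₀₁) f(x₁₀) f(x₁₁) dμ*)^{1/4}` of a bounded
measurable real-valued function `f`. -/
noncomputable def boxSeminorm {X : Type*} [MeasurableSpace X] [StandardBorelSpace X]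
    (μ : Measure X) [IsFiniteMeasure μ] (T₁ T₂ : X ≃ᵐ X) (f : X → ℝ) : ℝ :=
  (∫ p, f p.1.1 * f p.1.2 * f p.2.1 * f p.2.2 ∂(boxMeasure μ T₁ T₂)) ^ (1 / 4 : ℝ)

/-- `(X, μ, T₁, T₂)` is a magic system: it is a system and every bounded measurable `f` with
`E(f | I(T₁) ∨ I(T₂)) = 0` has zero box seminorm. -/
structure IsMagicSystem {X : Type*} [MeasurableSpace X] [StandardBorelSpace X]
    (μ : Measure X) [IsFiniteMeasure μ] (T₁ T₂ : X ≃ᵐ X) : Prop extends IsSystem μ T₁ T₂ where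
  boxSeminorm_eq_zero : ∀ f : X → ℝ, Measurable f → (∃ C : ℝ, ∀ x, |f x| ≤ C) →
    μ[f | MeasurableSpace.invariants T₁ ⊔ MeasurableSpace.invariants T₂] =ᵐ[μ] 0 →
    boxSeminorm μ T₁ T₂ f = 0

/-- The ergodic component `μ_x` of `μ` at `x` under `T₁` and `T₂`: the ergodic decomposition
`μ = ∫ μ_x dμ(x)` is the disintegration of `μ` over the σ-algebra `I(T₁) ∧ I(T₂)` of the
measurable sets invariant under both transformations, so that
`E(f | I(T₁) ∧ I(T₂))(x) = ∫ f dμ_x` for `μ`-almost every `x`. -/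
noncomputable def ergodicComponent {X : Type*} [MeasurableSpace X] [StandardBorelSpace X]
    (μ : Measure X) [IsFiniteMeasure μ] (T₁ T₂ : X ≃ᵐ X) (x : X) : Measure X :=
  condExpKernel μ (MeasurableSpace.invariants T₁ ⊓ MeasurableSpace.invariants T₂) x

/-- Ergodic components are probability measures. -/
instance ergodicComponent.instIsProbabilityMeasure {X : Type*} [MeasurableSpace X]
    [StandardBorelSpace X] (μ : Measure X) [IsFiniteMeasure μ] (T₁ T₂ : X ≃ᵐ X) (x : X) :
    IsProbabilityMeasure (ergodicComponent μ T₁ T₂ x) :=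
  inferInstanceAs (IsProbabilityMeasure (condExpKernel μ
    (MeasurableSpace.invariants T₁ ⊓ MeasurableSpace.invariants T₂) x))

/-! The form `boxForm` is linear in each entry, and by the mean ergodic theorem it is an iterated
Cesàro limit of integrals of bounded functions against `μ` (`IsSystem.tendsto_boxCorrelation`,
`IsSystem.tendsto_boxForm`). Such integrals are averages over the ergodic components, so by
dominated convergence the fourth power of the seminorm is too
(`IsSystem.integral_boxForm_ergodicComponent`). It is nonnegative, so a function of zero seminorm
for `μ` has zero seminorm for almost every `μ_x`.

The exceptional null set depends on the function, so this is applied to countably many functions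
only. Let `Z = I(T₁) ∨ I(T₂)`, let `s` run through a countable generating π-system and let `e s` be
a bounded `Z`-measurable version of `E_μ(1_s | Z)`. As the system is magic, `1_s - e s` has zero
seminorm for `μ`, hence for almost every `μ_x`, simultaneously in `s`.

Fix such an `x`, and `φ` with `E_{μ_x}(φ | Z) = 0`. The form with entries `1_s, φ, φ, φ` splits in
two: the part with `1_s - e s` vanishes by a Cauchy–Schwarz argument
(`IsSystem.boxForm_eq_zero_of_self`), the part with `e s` by orthogonality
(`IsSystem.boxForm_eq_zero_of_measurable`). Since `Z` consists of strictly invariant sets, it does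
not depend on the measure, and `e s` need not be a conditional expectation for `μ_x`. A π-λ argument
then allows `φ` as the first entry. -/

open Filter Topology

/-! ### Invariant σ-algebras and the mean ergodic theorem -/

section Invariants

variable {Y : Type*} [mY : MeasurableSpace Y] {ν : Measure Y}

/-- A function that is a.e. invariant under `T` is a.e. equal to a strictly invariant one. -/
theorem aestronglyMeasurable_invariants_of_comp_ae_eq {T : Y → Y} (hT : MeasurePreserving T ν ν)
    {g : Y → ℝ} (hg : AEStronglyMeasurable g ν) (h : g ∘ T =ᵐ[ν] g) :
    AEStronglyMeasurable[MeasurableSpace.invariants T] g ν := by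
  wlog hgm : Measurable g generalizing g with H
  · have hae : g =ᵐ[ν] hg.mk g := hg.ae_eq_mk
    have h' : hg.mk g ∘ T =ᵐ[ν] hg.mk g :=
      ((hT.quasiMeasurePreserving.ae_eq_comp hae).symm.trans h).trans hae
    exact (H hg.stronglyMeasurable_mk.aestronglyMeasurable h'
      hg.stronglyMeasurable_mk.measurable).congr hae.symm
  have hlim : Measurable fun x => limsup (fun n => g (T^[n] x)) atTop :=
    Measurable.limsup fun n => hgm.comp (hT.measurable.iterate n)
  -- The limsup along the orbit is unchanged by a shift, hence strictly invariant, and it equals `g`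
  -- wherever `g` is constant along the orbit.
  refine ⟨fun x => limsup (fun n => g (T^[n] x)) atTop, ?_, ?_⟩
  · refine Measurable.stronglyMeasurable ?_
    refine MeasurableSpace.measurable_invariants_dom.2 ⟨hlim, fun s _ => ?_⟩
    congr 1
    funext x
    change limsup (fun n => g (T^[n + 1] x)) atTop = _
    exact limsup_nat_add (fun n => g (T^[n] x)) 1
  · have hall : ∀ n, ∀ᵐ x ∂ν, g (T^[n] x) = g x := by
      intro n
      induction n with
      | zero => simp
      | succ n ih =>
        filter_upwards [h, hT.quasiMeasurePreserving.ae ih] with x hx hx'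
        rw [Function.iterate_succ_apply, hx']
        exact hx
    filter_upwards [ae_all_iff.2 hall] with x hx
    simp [hx]

theorem orthogonalProjectionOnto_congr {E : Type*} [NormedAddCommGroup E] [InnerProductSpace ℝ E]
    {K L : Submodule ℝ E} [K.HasOrthogonalProjection] [L.HasOrthogonalProjection] (h : K = L)
    (x : E) : (K.orthogonalProjectionOnto x : E) = L.orthogonalProjectionOnto x := by
  subst h
  rfl

/-- The weak form of the mean ergodic theorem, with the limit expressed by the conditional
expectation on the invariant σ-algebra. -/
theorem tendsto_average_integral_comp_iterate [IsFiniteMeasure ν] {T : Y → Y}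
    (hT : MeasurePreserving T ν ν) {f k : Y → ℝ} (hf : MemLp f 2 ν) (hk : MemLp k 2 ν) :
    Tendsto (fun N : ℕ => (N : ℝ)⁻¹ * ∑ n ∈ Finset.range N, ∫ x, k x * f (T^[n] x) ∂ν) atTop
      (𝓝 (∫ x, k x * (ν[f | MeasurableSpace.invariants T]) x ∂ν)) := by
  have hm : MeasurableSpace.invariants T ≤ mY := MeasurableSpace.invariants_le T
  let U : Lp ℝ 2 ν →L[ℝ] Lp ℝ 2 ν := (Lp.compMeasurePreservingₗᵢ ℝ T hT).toContinuousLinearMap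
  have hU : ∀ F : Lp ℝ 2 ν, U F = Lp.compMeasurePreserving T hT F := fun F => rfl
  have hU1 : ‖U‖ ≤ 1 := LinearIsometry.norm_toContinuousLinearMap_le _
  -- The fixed space of the Koopman operator consists of the `L²` functions measurable for the
  -- invariant σ-algebra, so von Neumann's projection is the conditional expectation.
  have hfix : U.eqLocus (1 : Lp ℝ 2 ν →L[ℝ] Lp ℝ 2 ν)
      = lpMeas ℝ ℝ (MeasurableSpace.invariants T) 2 ν := by
    ext G
    rw [mem_lpMeas_iff_aestronglyMeasurable]
    have hGT : (U G : Y → ℝ) =ᵐ[ν] G ∘ T := Lp.coeFn_compMeasurePreserving G hT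
    constructor
    · intro hG
      have hG' : U G = G := hG
      rw [hG'] at hGT
      exact aestronglyMeasurable_invariants_of_comp_ae_eq hT (Lp.aestronglyMeasurable G) hGT.symm
    · intro hG
      change U G = G
      refine Lp.ext (hGT.trans ?_)
      refine (hT.quasiMeasurePreserving.ae_eq_comp hG.ae_eq_mk).trans ?_
      rw [MeasurableSpace.comp_eq_of_measurable_invariants hG.stronglyMeasurable_mk.measurable]
      exact hG.ae_eq_mk.symm
  have hlim := U.tendsto_birkhoffAverage_orthogonalProjection hU1 (hf.toLp f)
  have hlim2 := (hlim.inner (𝕜 := ℝ) (tendsto_const_nhds (x := hk.toLp k)))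
  have hiter : ∀ n, (U^[n] (hf.toLp f) : Y → ℝ) =ᵐ[ν] fun x => f (T^[n] x) := by
    intro n
    have : U^[n] (hf.toLp f) = Lp.compMeasurePreserving (T^[n]) (hT.iterate n) (hf.toLp f) := by
      rw [← Lp.compMeasurePreserving_iterate]
      rfl
    rw [this]
    exact (Lp.coeFn_compMeasurePreserving _ _).trans
      ((hT.iterate n).quasiMeasurePreserving.ae_eq_comp hf.coeFn_toLp)
  have hproj : ((((U.eqLocus (1 : Lp ℝ 2 ν →L[ℝ] Lp ℝ 2 ν)).orthogonalProjectionOnto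
      (hf.toLp f)) : Lp ℝ 2 ν) : Y → ℝ) =ᵐ[ν] ν[f | MeasurableSpace.invariants T] := by
    have : Fact (MeasurableSpace.invariants T ≤ mY) := ⟨hm⟩
    rw [orthogonalProjectionOnto_congr hfix]
    exact hf.condExpL2_ae_eq_condExp hm (𝕜 := ℝ)
  refine (hlim2.congr fun N => ?_).trans (le_of_eq ?_)
  · rw [birkhoffAverage, birkhoffSum, real_inner_smul_left, sum_inner]
    congr 1
    refine Finset.sum_congr rfl fun n _ => ?_
    rw [L2.inner_def]
    refine integral_congr_ae ?_
    filter_upwards [hiter n, hk.coeFn_toLp] with x hx hx'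
    simp only [id, hx, hx']
    simp
  · congr 1
    rw [L2.inner_def]
    refine integral_congr_ae ?_
    filter_upwards [hproj, hk.coeFn_toLp] with x hx hx'
    rw [hx, hx']
    simp

/-- Conditional expectations on the invariants of `S` commute with an automorphism that commutes
with `S`. -/
theorem condExp_invariants_comp [IsFiniteMeasure ν] {S : Y → Y} {T : Y ≃ᵐ Y}
    (hT : MeasurePreserving T ν ν) (hST : ∀ x, S (T x) = T (S x)) {f : Y → ℝ}
    (hf : Integrable f ν) :
    ν[f ∘ T | MeasurableSpace.invariants S] =ᵐ[ν] ν[f | MeasurableSpace.invariants S] ∘ T := by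
  have hm : MeasurableSpace.invariants S ≤ mY := MeasurableSpace.invariants_le S
  have hST' : ∀ x, S (T.symm x) = T.symm (S x) := fun x => by
    apply T.injective
    rw [← hST, T.apply_symm_apply, T.apply_symm_apply]
  have hTm : @Measurable _ _ (MeasurableSpace.invariants S) (MeasurableSpace.invariants S) T :=
    MeasurableSpace.measurable_invariants_of_semiconj T.measurable fun x => (hST x).symm
  have hTm' : @Measurable _ _ (MeasurableSpace.invariants S) (MeasurableSpace.invariants S)
      T.symm :=
    MeasurableSpace.measurable_invariants_of_semiconj T.symm.measurable fun x => (hST' x).symm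
  symm
  have hint : Integrable (ν[f | MeasurableSpace.invariants S] ∘ T) ν :=
    hT.integrable_comp_of_integrable integrable_condExp
  refine ae_eq_condExp_of_forall_setIntegral_eq hm (hT.integrable_comp_of_integrable hf)
    (fun s _ _ => hint.integrableOn) (fun s hs _ => ?_)
    (stronglyMeasurable_condExp.comp_measurable hTm).aestronglyMeasurable
  -- Both `T` and its inverse commute with `S`, so every `S`-invariant set is the `T`-preimage of an
  -- `S`-invariant set.
  obtain ⟨B, hB, rfl⟩ : ∃ B, MeasurableSet[MeasurableSpace.invariants S] B ∧ T ⁻¹' B = s :=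
    ⟨T.symm ⁻¹' s, hTm' hs, by ext x; simp⟩
  have h1 := hT.setIntegral_preimage_emb T.measurableEmbedding
    (ν[f | MeasurableSpace.invariants S]) B
  have h2 := hT.setIntegral_preimage_emb T.measurableEmbedding f B
  simp only [Function.comp_apply]
  rw [h1, h2, setIntegral_condExp hm hf hB]

end Invariants

/-! ### Bounded measurable functions -/

/-- Bounded measurable real-valued functions. -/
def IsBddMeasurable {X : Type*} [MeasurableSpace X] (f : X → ℝ) : Prop :=
  Measurable f ∧ ∃ C : ℝ, ∀ x, |f x| ≤ C

namespace IsBddMeasurable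

variable {X Y : Type*} [MeasurableSpace X] [MeasurableSpace Y] {f g : X → ℝ}

theorem mul (hf : IsBddMeasurable f) (hg : IsBddMeasurable g) :
    IsBddMeasurable fun x => f x * g x := by
  obtain ⟨hfm, C, hC⟩ := hf
  obtain ⟨hgm, D, hD⟩ := hg
  refine ⟨hfm.mul hgm, C * D, fun x => ?_⟩
  rw [abs_mul]
  exact mul_le_mul (hC x) (hD x) (abs_nonneg _) ((abs_nonneg _).trans (hC x))

theorem sub (hf : IsBddMeasurable f) (hg : IsBddMeasurable g) :
    IsBddMeasurable fun x => f x - g x := by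
  obtain ⟨hfm, C, hC⟩ := hf
  obtain ⟨hgm, D, hD⟩ := hg
  exact ⟨hfm.sub hgm, C + D, fun x => (abs_sub _ _).trans (add_le_add (hC x) (hD x))⟩

theorem comp (hf : IsBddMeasurable f) {T : Y → X} (hT : Measurable T) :
    IsBddMeasurable fun y => f (T y) :=
  ⟨hf.1.comp hT, hf.2.imp fun _ hC y => hC (T y)⟩

theorem indicator {s : Set X} (hs : MeasurableSet s) : IsBddMeasurable (s.indicator (1 : X → ℝ)) :=
  ⟨measurable_one.indicator hs, 1, fun x => by
    by_cases hx : x ∈ s <;> simp [hx]⟩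

theorem tensor (hf : IsBddMeasurable f) (hg : IsBddMeasurable g) :
    IsBddMeasurable fun p : X × X => f p.1 * g p.2 :=
  (hf.comp measurable_fst).mul (hg.comp measurable_snd)

theorem memLp (hf : IsBddMeasurable f) (p : ENNReal) (ν : Measure X) [IsFiniteMeasure ν] :
    MemLp f p ν := by
  obtain ⟨hfm, C, hC⟩ := hf
  exact MemLp.of_bound hfm.aestronglyMeasurable C (Eventually.of_forall hC)

theorem integrable (hf : IsBddMeasurable f) (ν : Measure X) [IsFiniteMeasure ν] :
    Integrable f ν :=
  memLp_one_iff_integrable.1 (hf.memLp 1 ν)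

end IsBddMeasurable

/-! ### Conditional expectations and integrals against generated σ-algebras -/

section CondExp

variable {Y : Type*} [mY : MeasurableSpace Y] {ν : Measure Y} [IsFiniteMeasure ν]

/-- Conditional expectation is self-adjoint and idempotent. -/
theorem integral_condExp_mul_condExp {m : MeasurableSpace Y} (hm : m ≤ mY) {f g : Y → ℝ}
    (hf : MemLp f ⊤ ν) (hg : MemLp g ⊤ ν) :
    ∫ x, (ν[f | m]) x * (ν[g | m]) x ∂ν = ∫ x, f x * (ν[g | m]) x ∂ν := by
  have hgc : MemLp (ν[g | m]) ⊤ ν := hg.condExp le_top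
  have h := condExp_mul_of_stronglyMeasurable_right (m := m) (μ := ν) (f := f) (g := ν[g | m])
    stronglyMeasurable_condExp ((hgc.mul hf).integrable le_top) (hf.integrable le_top)
  exact (integral_congr_ae h).symm.trans (integral_condExp hm)

/-- A bounded function whose integral vanishes on a generating π-system integrates to zero
against every bounded function that is measurable for the generated σ-algebra. -/
theorem integral_comp_mul_eq_zero {Ω X : Type*} [mΩ : MeasurableSpace Ω] [mX : MeasurableSpace X]
    {ρ : Measure Ω} [IsFiniteMeasure ρ] {p : Ω → X} (hp : Measurable p) {W : Ω → ℝ}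
    (hW : Integrable W ρ) {m : MeasurableSpace X} (hm : m ≤ mX) {𝒞 : Set (Set X)}
    (hgen : m = MeasurableSpace.generateFrom 𝒞) (hpi : IsPiSystem 𝒞) (huniv : Set.univ ∈ 𝒞)
    (h0 : ∀ s ∈ 𝒞, ∫ ω in p ⁻¹' s, W ω ∂ρ = 0) {h : X → ℝ} (hh : Measurable[m] h)
    (hb : ∃ C : ℝ, ∀ x, |h x| ≤ C) :
    ∫ ω, h (p ω) * W ω ∂ρ = 0 := by
  have hall : ∀ s, MeasurableSet[m] s → ∫ ω in p ⁻¹' s, W ω ∂ρ = 0 := by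
    refine MeasurableSpace.induction_on_inter hgen hpi (by simp) h0 ?_ ?_
    · intro t ht h
      have h1 := integral_add_compl (hp (hm _ ht)) hW
      have h2 := h0 _ huniv
      rw [Set.preimage_univ, setIntegral_univ] at h2
      rw [h, h2, zero_add] at h1
      exact h1
    · intro f hd hf h
      rw [Set.preimage_iUnion, integral_iUnion (fun i => hp (hm _ (hf i)))
        (fun i j hij => (hd hij).preimage p) hW.integrableOn]
      simp [h]
  -- Vanishing on all sets of `m.comap p` means that `W` has zero conditional expectation there, and
  -- `h ∘ p` can be pulled out.
  have hle : m.comap p ≤ mΩ := (MeasurableSpace.comap_mono hm).trans hp.comap_le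
  have hW0 : ρ[W | m.comap p] =ᵐ[ρ] 0 := by
    symm
    refine ae_eq_condExp_of_forall_setIntegral_eq hle hW (fun _ _ _ => integrableOn_zero) ?_
      stronglyMeasurable_zero.aestronglyMeasurable
    rintro _ ⟨s, hs, rfl⟩ _
    simp [hall s hs]
  have hhp : Measurable[m.comap p] fun ω => h (p ω) := hh.comp (comap_measurable p)
  obtain ⟨C, hC⟩ := hb
  have hpull := condExp_mul_of_stronglyMeasurable_left (m := m.comap p) (μ := ρ) (g := W)
    hhp.stronglyMeasurable (hW.bdd_mul (c := C) (hhp.mono hle le_rfl).aestronglyMeasurable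
      (Eventually.of_forall fun ω => hC (p ω))) hW
  rw [← integral_condExp hle]
  change ∫ ω, (ρ[(fun ω => h (p ω)) * W | m.comap p]) ω ∂ρ = 0
  rw [integral_congr_ae hpull]
  refine integral_eq_zero_of_ae ?_
  filter_upwards [hW0] with ω hω
  simp [hω]

end CondExp

/-! ### Relatively independent squares -/

section RelSquare

variable {X : Type*} {m : MeasurableSpace X} [mX : MeasurableSpace X] [StandardBorelSpace X]
  {μ : Measure X} [IsFiniteMeasure μ]

theorem integral_relSquare (hm : m ≤ mX) {f g : X → ℝ}
    (hf : IsBddMeasurable f) (hg : IsBddMeasurable g) :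
    ∫ p, f p.1 * g p.2 ∂(relSquare m μ) = ∫ x, (μ[f | m]) x * (μ[g | m]) x ∂μ := by
  let η : Kernel X (X × X) := ⟨_, measurable_condExpKernel_prod m μ⟩
  have hη : (η ∘ₖ Kernel.const Unit μ) () = relSquare m μ := by
    rw [Kernel.comp_apply, Kernel.const_apply]
    rfl
  have hint : Integrable (fun p : X × X => f p.1 * g p.2) (relSquare m μ) :=
    ((hf.comp measurable_fst).mul (hg.comp measurable_snd)).integrable _
  rw [← hη] at hint ⊢
  rw [Kernel.integral_comp hint, Kernel.const_apply]
  refine integral_congr_ae ?_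
  filter_upwards [condExp_ae_eq_integral_condExpKernel hm (hf.integrable μ),
    condExp_ae_eq_integral_condExpKernel hm (hg.integrable μ)] with x hx hx'
  rw [hx, hx']
  exact integral_prod_mul (μ := condExpKernel μ m x) (ν := condExpKernel μ m x) f g

/-- A measure on the product is determined by rectangles. Their mass is an integral of conditional
expectations, which `T` only translates. -/
theorem measurePreserving_relSquare (hm : m ≤ mX) {T : X → X} (hT : MeasurePreserving T μ μ)
    (hcomm : ∀ f : X → ℝ, Integrable f μ → μ[f ∘ T | m] =ᵐ[μ] μ[f | m] ∘ T) :
    MeasurePreserving (Prod.map T T) (relSquare m μ) (relSquare m μ) := by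
  have hmeas : Measurable (Prod.map T T) := hT.measurable.prodMap hT.measurable
  refine ⟨hmeas, ?_⟩
  have : IsFiniteMeasure ((relSquare m μ).map (Prod.map T T)) := inferInstance
  have hreal : ∀ s t : Set X, MeasurableSet s → MeasurableSet t → (relSquare m μ).real (s ×ˢ t) =
      ∫ x, (μ[s.indicator (1 : X → ℝ) | m]) x * (μ[t.indicator (1 : X → ℝ) | m]) x ∂μ := by
    intro s t hs ht
    rw [← integral_relSquare hm (.indicator hs) (.indicator ht),
      ← integral_indicator_one (hs.prod ht)]
    refine integral_congr_ae (Eventually.of_forall fun p => ?_)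
    by_cases h1 : p.1 ∈ s <;> by_cases h2 : p.2 ∈ t <;> simp [Set.indicator, h1, h2]
  refine Measure.ext_prod fun {s t} hs ht => ?_
  rw [Measure.map_apply hmeas (hs.prod ht), Set.preimage_prod_map_prod,
    ← measureReal_eq_measureReal_iff, hreal _ _ (hT.measurable hs) (hT.measurable ht),
    hreal _ _ hs ht]
  have hcs := hcomm _ ((IsBddMeasurable.indicator hs).integrable μ)
  have hct := hcomm _ ((IsBddMeasurable.indicator ht).integrable μ)
  let K : X → ℝ := fun x =>
    (μ[s.indicator (1 : X → ℝ) | m]) x * (μ[t.indicator (1 : X → ℝ) | m]) x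
  have hK : AEStronglyMeasurable K μ :=
    (integrable_condExp.aestronglyMeasurable).mul integrable_condExp.aestronglyMeasurable
  have hmap : ∫ x, K (T x) ∂μ = ∫ x, K x ∂μ := by
    conv_rhs => rw [← hT.map_eq]
    rw [integral_map hT.measurable.aemeasurable (by rwa [hT.map_eq])]
  refine Eq.trans (integral_congr_ae ?_) hmap
  filter_upwards [hcs, hct] with x hx hx'
  exact congrArg₂ (· * ·) hx hx'

end RelSquare

/-! ### The box form as an iterated Cesàro limit -/

section Correlation

variable {X : Type*} [mX : MeasurableSpace X] {μ : Measure X} [IsFiniteMeasure μ] {T₁ T₂ : X ≃ᵐ X}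

/-- The correlations whose averages over `n` converge to `boxForm`. -/
noncomputable def boxCorrelation (μ : Measure X) (T₁ T₂ : X ≃ᵐ X)
    (f₀ f₁ f₂ f₃ : X → ℝ) (n : ℕ) : ℝ :=
  ∫ x, (μ[fun x => f₀ x * f₂ (T₂^[n] x) | MeasurableSpace.invariants T₁]) x *
    (μ[fun x => f₁ x * f₃ (T₂^[n] x) | MeasurableSpace.invariants T₁]) x ∂μ

/-- One of the two conditional expectations is redundant by self-adjointness, and the other is a
weak limit of averages along `T₁`. What remains are plain integrals, which disintegrate over the
ergodic components. -/
theorem IsSystem.tendsto_boxCorrelation (h : IsSystem μ T₁ T₂) {f₀ f₁ f₂ f₃ : X → ℝ}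
    (h₀ : IsBddMeasurable f₀) (h₁ : IsBddMeasurable f₁) (h₂ : IsBddMeasurable f₂)
    (h₃ : IsBddMeasurable f₃) (n : ℕ) :
    Tendsto (fun M : ℕ => (M : ℝ)⁻¹ * ∑ k ∈ Finset.range M,
        ∫ x, (f₀ x * f₂ (T₂^[n] x)) * (f₁ (T₁^[k] x) * f₃ (T₂^[n] (T₁^[k] x))) ∂μ)
      atTop (𝓝 (boxCorrelation μ T₁ T₂ f₀ f₁ f₂ f₃ n)) := by
  have hT := T₂.measurable.iterate n
  rw [boxCorrelation, integral_condExp_mul_condExp (MeasurableSpace.invariants_le _)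
    ((h₀.mul (h₂.comp hT)).memLp _ _) ((h₁.mul (h₃.comp hT)).memLp _ _)]
  exact tendsto_average_integral_comp_iterate h.measurePreserving_fst
    ((h₁.mul (h₃.comp hT)).memLp _ _) ((h₀.mul (h₂.comp hT)).memLp _ _)

end Correlation

section Box

variable {X : Type*} [mX : MeasurableSpace X] [StandardBorelSpace X] {μ : Measure X}
  [IsFiniteMeasure μ] {T₁ T₂ : X ≃ᵐ X}

/-- The multilinear form associated with the box seminorm. -/
noncomputable def boxForm (μ : Measure X) [IsFiniteMeasure μ] (T₁ T₂ : X ≃ᵐ X)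
    (f₀ f₁ f₂ f₃ : X → ℝ) : ℝ :=
  ∫ p, f₀ p.1.1 * f₁ p.1.2 * f₂ p.2.1 * f₃ p.2.2 ∂(boxMeasure μ T₁ T₂)

theorem boxForm_eq_integral_condExp {f₀ f₁ f₂ f₃ : X → ℝ} (h₀ : IsBddMeasurable f₀)
    (h₁ : IsBddMeasurable f₁) (h₂ : IsBddMeasurable f₂) (h₃ : IsBddMeasurable f₃) :
    boxForm μ T₁ T₂ f₀ f₁ f₂ f₃ =
      ∫ q, ((relSquare (MeasurableSpace.invariants T₁) μ)[fun p : X × X => f₀ p.1 * f₁ p.2 |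
        MeasurableSpace.invariants (Prod.map T₂ T₂)]) q *
      ((relSquare (MeasurableSpace.invariants T₁) μ)[fun p : X × X => f₂ p.1 * f₃ p.2 |
        MeasurableSpace.invariants (Prod.map T₂ T₂)]) q
      ∂(relSquare (MeasurableSpace.invariants T₁) μ) := by
  rw [← integral_relSquare (MeasurableSpace.invariants_le _) (h₀.tensor h₁) (h₂.tensor h₃), boxForm]
  simp only [mul_assoc, boxMeasure]

theorem IsSystem.measurePreserving_prod (h : IsSystem μ T₁ T₂) :
    MeasurePreserving (Prod.map T₂ T₂) (relSquare (MeasurableSpace.invariants T₁) μ)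
      (relSquare (MeasurableSpace.invariants T₁) μ) :=
  measurePreserving_relSquare (MeasurableSpace.invariants_le _) h.measurePreserving_snd
    fun _ hf => condExp_invariants_comp h.measurePreserving_snd h.commute hf

/-- The mean ergodic theorem for `T₂ × T₂` on the relative square over `I(T₁)`; integrating a tensor
product there gives the correlations. -/
theorem IsSystem.tendsto_boxForm (h : IsSystem μ T₁ T₂) {f₀ f₁ f₂ f₃ : X → ℝ}
    (h₀ : IsBddMeasurable f₀) (h₁ : IsBddMeasurable f₁) (h₂ : IsBddMeasurable f₂)
    (h₃ : IsBddMeasurable f₃) :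
    Tendsto (fun N : ℕ => (N : ℝ)⁻¹ * ∑ n ∈ Finset.range N, boxCorrelation μ T₁ T₂ f₀ f₁ f₂ f₃ n)
      atTop (𝓝 (boxForm μ T₁ T₂ f₀ f₁ f₂ f₃)) := by
  rw [boxForm_eq_integral_condExp h₀ h₁ h₂ h₃, integral_condExp_mul_condExp
    (MeasurableSpace.invariants_le _) ((h₀.tensor h₁).memLp _ _) ((h₂.tensor h₃).memLp _ _)]
  refine (tendsto_average_integral_comp_iterate h.measurePreserving_prod
    ((h₂.tensor h₃).memLp _ _) ((h₀.tensor h₁).memLp _ _)).congr fun N => ?_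
  congr 1
  refine Finset.sum_congr rfl fun n _ => ?_
  have hT := T₂.measurable.iterate n
  rw [boxCorrelation, ← integral_relSquare (MeasurableSpace.invariants_le _)
    (h₀.mul (h₂.comp hT)) (h₁.mul (h₃.comp hT))]
  refine integral_congr_ae (Eventually.of_forall fun p => ?_)
  simp only [Prod.map_iterate, Prod.map_fst, Prod.map_snd]
  ring

theorem boxForm_self_nonneg {f : X → ℝ} (hf : IsBddMeasurable f) :
    0 ≤ boxForm μ T₁ T₂ f f f f := by
  rw [boxForm_eq_integral_condExp hf hf hf hf]
  exact integral_nonneg fun _ => mul_self_nonneg _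

theorem boxSeminorm_eq_zero_iff {f : X → ℝ} (hf : IsBddMeasurable f) :
    boxSeminorm μ T₁ T₂ f = 0 ↔ boxForm μ T₁ T₂ f f f f = 0 := by
  change boxForm μ T₁ T₂ f f f f ^ (1 / 4 : ℝ) = 0 ↔ _
  rw [Real.rpow_eq_zero (boxForm_self_nonneg hf) (by norm_num)]

end Box

/-! ### Conditional expectations along orbits and averaged limits -/

section CondExpIterate

variable {Y : Type*} {m : MeasurableSpace Y} [mY : MeasurableSpace Y] {ν : Measure Y} [IsFiniteMeasure ν]

theorem condExp_invariants_comp_iterate {S : Y → Y} {T : Y ≃ᵐ Y}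
    (hT : MeasurePreserving T ν ν) (hST : ∀ x, S (T x) = T (S x)) {f : Y → ℝ}
    (hf : Integrable f ν) (n : ℕ) :
    ν[fun x => f (T^[n] x) | MeasurableSpace.invariants S] =ᵐ[ν]
      fun x => (ν[f | MeasurableSpace.invariants S]) (T^[n] x) := by
  induction n with
  | zero => rfl
  | succ n ih =>
    exact (condExp_invariants_comp hT hST ((hT.iterate n).integrable_comp_of_integrable hf)).trans
      (hT.quasiMeasurePreserving.ae_eq_comp ih)

/-- Conditional expectations on σ-algebras of invariant sets do not see the transformation. -/
theorem condExp_comp_of_le_invariants {T : Y ≃ᵐ Y} (hT : MeasurePreserving T ν ν)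
    (hm : m ≤ MeasurableSpace.invariants T) {f : Y → ℝ}
    (hf : Integrable f ν) : ν[f ∘ T | m] =ᵐ[ν] ν[f | m] := by
  have hmY : m ≤ mY := hm.trans (MeasurableSpace.invariants_le T)
  symm
  refine ae_eq_condExp_of_forall_setIntegral_eq hmY (hT.integrable_comp_of_integrable hf)
    (fun s _ _ => integrable_condExp.integrableOn) (fun s hs _ => ?_)
    stronglyMeasurable_condExp.aestronglyMeasurable
  rw [setIntegral_condExp hmY hf hs, ← hT.setIntegral_preimage_emb T.measurableEmbedding f s,
    (hm s hs).2]
  rfl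

/-- Dominated convergence for Cesàro averages. -/
theorem tendsto_average_integral {v : ℕ → Y → ℝ} {w : Y → ℝ} {C : ℝ}
    (hv : ∀ k, AEStronglyMeasurable (v k) ν) (hC : ∀ k, ∀ᵐ x ∂ν, |v k x| ≤ C)
    (hlim : ∀ᵐ x ∂ν, Tendsto (fun N : ℕ => (N : ℝ)⁻¹ * ∑ k ∈ Finset.range N, v k x) atTop
      (𝓝 (w x))) :
    AEStronglyMeasurable w ν ∧ (∀ᵐ x ∂ν, |w x| ≤ C) ∧
      Tendsto (fun N : ℕ => (N : ℝ)⁻¹ * ∑ k ∈ Finset.range N, ∫ x, v k x ∂ν) atTop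
        (𝓝 (∫ x, w x ∂ν)) := by
  have hint : ∀ k, Integrable (v k) ν := fun k =>
    memLp_one_iff_integrable.1 (MemLp.of_bound (hv k) C (hC k))
  have hmeas : ∀ N : ℕ, AEStronglyMeasurable
      (fun x => (N : ℝ)⁻¹ * ∑ k ∈ Finset.range N, v k x) ν := fun N =>
    ((integrable_finsetSum _ fun k _ => hint k).const_mul _).aestronglyMeasurable
  have hbound : ∀ᵐ x ∂ν, ∀ N : ℕ, |(N : ℝ)⁻¹ * ∑ k ∈ Finset.range N, v k x| ≤ C := by
    filter_upwards [ae_all_iff.2 hC] with x hx N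
    rcases N.eq_zero_or_pos with rfl | hN
    -- The empty average is `0`; that `C` is nonnegative is read off from the bound on `v 0 x`.
    · simpa using (abs_nonneg _).trans (hx 0)
    · have hN' : (0 : ℝ) < N := Nat.cast_pos.2 hN
      rw [abs_mul, abs_of_pos (inv_pos.2 hN'), inv_mul_le_iff₀ hN']
      refine (Finset.abs_sum_le_sum_abs _ _).trans ?_
      simpa using Finset.sum_le_card_nsmul (Finset.range N) (fun k => |v k x|) C fun k _ => hx k
  refine ⟨aestronglyMeasurable_of_tendsto_ae atTop hmeas hlim, ?_, ?_⟩
  · filter_upwards [hbound, hlim] with x hx hx'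
    exact le_of_tendsto hx'.abs (Eventually.of_forall hx)
  · refine (tendsto_integral_of_dominated_convergence (fun _ => C) hmeas (integrable_const C)
      (fun N => hbound.mono fun x hx => hx N) hlim).congr fun N => ?_
    rw [integral_const_mul, integral_finsetSum _ fun k _ => hint k]

end CondExpIterate

theorem IsBddMeasurable.tensor_three {X : Type*} [MeasurableSpace X] {f₁ f₂ f₃ : X → ℝ}
    (h₁ : IsBddMeasurable f₁) (h₂ : IsBddMeasurable f₂) (h₃ : IsBddMeasurable f₃) :
    IsBddMeasurable fun p : (X × X) × (X × X) => f₁ p.1.2 * f₂ p.2.1 * f₃ p.2.2 :=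
  ((h₁.comp (measurable_snd.comp measurable_fst)).mul
    (h₂.comp (measurable_fst.comp measurable_snd))).mul
    (h₃.comp (measurable_snd.comp measurable_snd))

/-! ### Vanishing of the box form -/

section BoxVanishing

variable {X : Type*} {m : MeasurableSpace X} [mX : MeasurableSpace X] [StandardBorelSpace X]
  {ν : Measure X} [IsFiniteMeasure ν] {T₁ T₂ : X ≃ᵐ X}

/-- This is Cauchy–Schwarz applied twice, in vanishing form: across the two conditional expectations
on `I(T₁)` it kills the form at `g, φ, g, φ`, and then across those on `I(T₂ × T₂)` it kills the
form at `g, φ, φ, φ`. -/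
theorem IsSystem.boxForm_eq_zero_of_self (h : IsSystem ν T₁ T₂) {g φ : X → ℝ}
    (hg : IsBddMeasurable g) (hφ : IsBddMeasurable φ) (h0 : boxForm ν T₁ T₂ g g g g = 0) :
    boxForm ν T₁ T₂ g φ φ φ = 0 := by
  -- A weighted bound `ab ≤ t a² + t⁻¹ b²` for the correlations; the `t a²` term contributes a
  -- multiple of `h0`, and `t → ∞` removes the other.
  have hle : ∀ t : ℝ, 0 < t →
      boxForm ν T₁ T₂ g φ g φ ≤ t⁻¹ * boxForm ν T₁ T₂ φ φ φ φ := by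
    intro t ht
    have hlim := ((h.tendsto_boxForm hg hg hg hg).const_mul t).add
      ((h.tendsto_boxForm hφ hφ hφ hφ).const_mul t⁻¹)
    rw [h0, mul_zero, zero_add] at hlim
    refine le_of_tendsto_of_tendsto' (h.tendsto_boxForm hg hφ hg hφ) hlim fun N => ?_
    rw [mul_left_comm t, mul_left_comm t⁻¹, ← mul_add, Finset.mul_sum _ _ t,
      Finset.mul_sum _ _ t⁻¹,
      ← Finset.sum_add_distrib]
    refine mul_le_mul_of_nonneg_left (Finset.sum_le_sum fun n _ => ?_) (by positivity)
    have hT := T₂.measurable.iterate n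
    have ha : MemLp (ν[fun x => g x * g (T₂^[n] x) | MeasurableSpace.invariants T₁]) ⊤ ν :=
      ((hg.mul (hg.comp hT)).memLp ⊤ ν).condExp le_top
    have hb : MemLp (ν[fun x => φ x * φ (T₂^[n] x) | MeasurableSpace.invariants T₁]) ⊤ ν :=
      ((hφ.mul (hφ.comp hT)).memLp ⊤ ν).condExp le_top
    have haa := (ha.mul' ha (r := ⊤)).integrable le_top
    have hab := (hb.mul' ha (r := ⊤)).integrable le_top
    have hbb := (hb.mul' hb (r := ⊤)).integrable le_top
    rw [boxCorrelation, boxCorrelation, boxCorrelation, ← integral_const_mul, ← integral_const_mul,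
      ← integral_add (haa.const_mul t) (hbb.const_mul t⁻¹)]
    refine integral_mono hab ((haa.const_mul t).add (hbb.const_mul t⁻¹)) fun x => ?_
    simp only
    generalize (ν[fun x => g x * g (T₂^[n] x) | MeasurableSpace.invariants T₁]) x = a
    generalize (ν[fun x => φ x * φ (T₂^[n] x) | MeasurableSpace.invariants T₁]) x = b
    have h1 : t * t⁻¹ = 1 := mul_inv_cancel₀ ht.ne'
    have h2 : 0 < t⁻¹ := inv_pos.2 ht
    have h3 : t * (a * a) + t⁻¹ * (b * b) - a * b
        = t⁻¹ * ((t * a - b / 2) ^ 2 + 3 / 4 * b ^ 2) := by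
      field_simp
      ring
    have h4 : 0 ≤ t⁻¹ * ((t * a - b / 2) ^ 2 + 3 / 4 * b ^ 2) := by positivity
    linarith
  have hle0 : boxForm ν T₁ T₂ g φ g φ ≤ 0 := by
    have hlim : Tendsto (fun t : ℝ => t⁻¹ * boxForm ν T₁ T₂ φ φ φ φ) atTop (𝓝 0) := by
      simpa using tendsto_inv_atTop_zero.mul_const (boxForm ν T₁ T₂ φ φ φ φ)
    exact ge_of_tendsto hlim ((eventually_gt_atTop 0).mono hle)
  -- At `g, φ, g, φ` the form is the integral of the square of `E(g ⊗ φ | I(T₂ × T₂))`, which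
  -- therefore vanishes almost everywhere.
  rw [boxForm_eq_integral_condExp hg hφ hg hφ] at hle0
  have hF := ((hg.tensor hφ).memLp ⊤ (relSquare (MeasurableSpace.invariants T₁) ν)).condExp
    (m := MeasurableSpace.invariants (Prod.map T₂ T₂)) le_top
  have hFF := (hF.mul' hF (r := ⊤)).integrable le_top
  have hzero := (integral_eq_zero_iff_of_nonneg (fun _ => mul_self_nonneg _) hFF).1
    (le_antisymm hle0 (integral_nonneg fun _ => mul_self_nonneg _))
  rw [boxForm_eq_integral_condExp hg hφ hφ hφ]
  refine integral_eq_zero_of_ae ?_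
  filter_upwards [hzero] with q hq
  rw [mul_self_eq_zero.1 hq, zero_mul]
  rfl

/-- The box form vanishes if its first entry is a product of indicators of invariant sets and the
other entries are orthogonal to `I(T₁) ∨ I(T₂)`. -/
theorem IsSystem.boxForm_indicator_inter_eq_zero (h : IsSystem ν T₁ T₂) {φ : X → ℝ}
    (hφ : IsBddMeasurable φ)
    (h0 : ν[φ | MeasurableSpace.invariants T₁ ⊔ MeasurableSpace.invariants T₂] =ᵐ[ν] 0)
    {A B : Set X} (hA : MeasurableSet[MeasurableSpace.invariants T₁] A)
    (hB : MeasurableSet[MeasurableSpace.invariants T₂] B) :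
    boxForm ν T₁ T₂ ((A ∩ B).indicator 1) φ φ φ = 0 := by
  have hm₁ := MeasurableSpace.invariants_le T₁
  have hm₂ := MeasurableSpace.invariants_le T₂
  set a : X → ℝ := A.indicator 1 with ha_def
  set b : X → ℝ := B.indicator 1 with hb_def
  have ha : IsBddMeasurable a := .indicator (hm₁ _ hA)
  have hb : IsBddMeasurable b := .indicator (hm₂ _ hB)
  have ha' : StronglyMeasurable[MeasurableSpace.invariants T₁] a :=
    stronglyMeasurable_one.indicator hA
  have hbT : ∀ n x, b (T₂^[n] x) = b x := by
    have hpre : T₂ ⁻¹' B = B := hB.2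
    have h1 : ∀ x, b (T₂ x) = b x := fun x => by
      have hiff : T₂ x ∈ B ↔ x ∈ B := by rw [← Set.mem_preimage, hpre]
      by_cases hx : x ∈ B <;> simp [hb_def, hiff, hx]
    intro n
    induction n with
    | zero => exact fun x => rfl
    | succ n ih => exact fun x => by rw [Function.iterate_succ_apply, ih, h1]
  have haφ : MemLp (fun x => a x * φ x) ⊤ ν := (ha.mul hφ).memLp ⊤ ν
  have hbφ : MemLp (fun x => b x * φ x) ⊤ ν := (hb.mul hφ).memLp ⊤ ν
  let ψ : X → ℝ := ν[fun x => b x * φ x | MeasurableSpace.invariants T₁]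
  let χ : X → ℝ := ν[fun x => a x * φ x | MeasurableSpace.invariants T₂]
  have hψ : MemLp ψ ⊤ ν := hbφ.condExp le_top
  have hχ : MemLp χ ⊤ ν := haφ.condExp le_top
  have hφψ : MemLp (fun x => φ x * ψ x) ⊤ ν := hψ.mul' (hφ.memLp ⊤ ν)
  -- The factor `a` comes out of the conditional expectation on `I(T₁)`, while `b`, being
  -- `T₂`-invariant, moves to the factor translated by `T₂^n`, where it turns into `ψ`.
  have hcorr : ∀ n, boxCorrelation ν T₁ T₂ ((A ∩ B).indicator 1) φ φ φ n =
      ∫ x, (a x * φ x) * (φ (T₂^[n] x) * ψ (T₂^[n] x)) ∂ν := by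
    intro n
    have hT := T₂.measurable.iterate n
    have hX : IsBddMeasurable fun x => b (T₂^[n] x) * φ (T₂^[n] x) :=
      (hb.comp hT).mul (hφ.comp hT)
    have hY : IsBddMeasurable fun x => φ x * φ (T₂^[n] x) := hφ.mul (hφ.comp hT)
    have e0 : (fun x => (A ∩ B).indicator (1 : X → ℝ) x * φ (T₂^[n] x)) =
        a * fun x => b (T₂^[n] x) * φ (T₂^[n] x) := by
      funext x
      rw [Pi.mul_apply, hbT, ← mul_assoc]
      by_cases h1 : x ∈ A <;> by_cases h2 : x ∈ B <;> simp [ha_def, hb_def, h1, h2]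
    have e1 := condExp_mul_of_stronglyMeasurable_left (μ := ν) ha'
      ((ha.mul hX).integrable ν) (hX.integrable ν)
    have e2 := condExp_mul_of_stronglyMeasurable_left (μ := ν) ha'
      ((ha.mul hY).integrable ν) (hY.integrable ν)
    have e3 := condExp_invariants_comp_iterate h.measurePreserving_snd h.commute
      ((hb.mul hφ).integrable ν) n
    have e4 := integral_condExp_mul_condExp hm₁ ((ha.mul hY).memLp ⊤ ν) (hX.memLp ⊤ ν)
    rw [boxCorrelation, e0]
    refine Eq.trans (integral_congr_ae ?_) (e4.trans (integral_congr_ae ?_))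
    · filter_upwards [e1, e2] with x h1 h2
      have h2' : (ν[fun x => a x * (φ x * φ (T₂^[n] x)) | MeasurableSpace.invariants T₁]) x =
        a x * (ν[fun x => φ x * φ (T₂^[n] x) | MeasurableSpace.invariants T₁]) x := h2
      rw [h1, h2', Pi.mul_apply]
      ring
    · filter_upwards [e3] with x h3
      rw [h3]
      ring
  have hlim := tendsto_average_integral_comp_iterate h.measurePreserving_snd
    (hφψ.mono_exponent le_top) (haφ.mono_exponent le_top)
  have hform := h.tendsto_boxForm (.indicator ((hm₁ _ hA).inter (hm₂ _ hB))) hφ hφ hφ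
  simp only [hcorr] at hform
  rw [tendsto_nhds_unique hform hlim, ← integral_condExp_mul_condExp hm₂ haφ hφψ]
  have hswap := integral_condExp_mul_condExp hm₂ hφψ haφ
  -- The limit equals `∫ φ ψ χ`, with `ψ` measurable for `I(T₁)` and `χ` for `I(T₂)`, so `φ` is
  -- orthogonal to the product.
  have hZ : StronglyMeasurable[MeasurableSpace.invariants T₁ ⊔ MeasurableSpace.invariants T₂]
      (ψ * χ) :=
    (stronglyMeasurable_condExp.mono le_sup_left).mul (stronglyMeasurable_condExp.mono le_sup_right)
  have hpull := condExp_mul_of_stronglyMeasurable_left (μ := ν) hZ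
    (((hφ.memLp ⊤ ν).mul (hχ.mul hψ (r := ⊤)) (r := ⊤)).integrable le_top) (hφ.integrable ν)
  calc ∫ x, χ x * (ν[fun x => φ x * ψ x | MeasurableSpace.invariants T₂]) x ∂ν
      = ∫ x, (φ x * ψ x) * χ x ∂ν := by
        rw [← hswap]
        exact integral_congr_ae (Eventually.of_forall fun x => mul_comm _ _)
    _ = ∫ x, (ψ * χ * φ) x ∂ν := by
        refine integral_congr_ae (Eventually.of_forall fun x => ?_)
        simp only [Pi.mul_apply]
        ring
    _ = 0 := by
        rw [← integral_condExp (sup_le hm₁ hm₂), integral_congr_ae hpull]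
        refine integral_eq_zero_of_ae ?_
        filter_upwards [h0] with x hx
        simp [hx]

theorem boxForm_eq_integral_fst (f₀ f₁ f₂ f₃ : X → ℝ) :
    boxForm ν T₁ T₂ f₀ f₁ f₂ f₃ =
      ∫ p, f₀ p.1.1 * (f₁ p.1.2 * f₂ p.2.1 * f₃ p.2.2) ∂(boxMeasure ν T₁ T₂) := by
  simp only [boxForm, mul_assoc]

instance boxMeasure.instIsFiniteMeasure : IsFiniteMeasure (boxMeasure ν T₁ T₂) :=
  inferInstanceAs (IsFiniteMeasure (relSquare (MeasurableSpace.invariants (Prod.map T₂ T₂))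
    (relSquare (MeasurableSpace.invariants T₁) ν)))

theorem boxForm_sub_left {f g f₁ f₂ f₃ : X → ℝ} (hf : IsBddMeasurable f) (hg : IsBddMeasurable g)
    (h₁ : IsBddMeasurable f₁) (h₂ : IsBddMeasurable f₂) (h₃ : IsBddMeasurable f₃) :
    boxForm ν T₁ T₂ (fun x => f x - g x) f₁ f₂ f₃ =
      boxForm ν T₁ T₂ f f₁ f₂ f₃ - boxForm ν T₁ T₂ g f₁ f₂ f₃ := by
  have hp : Measurable fun p : (X × X) × (X × X) => p.1.1 := measurable_fst.comp measurable_fst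
  simp only [boxForm_eq_integral_fst, sub_mul]
  exact integral_sub (((hf.comp hp).mul (h₁.tensor_three h₂ h₃)).integrable _)
    (((hg.comp hp).mul (h₁.tensor_three h₂ h₃)).integrable _)

/-- It is enough that the box form vanishes for first entries in a π-system of indicators. -/
theorem boxForm_eq_zero_of_generateFrom (hm : m ≤ mX) {𝒞 : Set (Set X)}
    (hgen : m = MeasurableSpace.generateFrom 𝒞) (hpi : IsPiSystem 𝒞) (huniv : Set.univ ∈ 𝒞)
    {f₁ f₂ f₃ : X → ℝ} (h₁ : IsBddMeasurable f₁)
    (h₂ : IsBddMeasurable f₂) (h₃ : IsBddMeasurable f₃)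
    (h0 : ∀ s ∈ 𝒞, boxForm ν T₁ T₂ (s.indicator 1) f₁ f₂ f₃ = 0) {h : X → ℝ}
    (hh : Measurable[m] h) (hb : ∃ C : ℝ, ∀ x, |h x| ≤ C) :
    boxForm ν T₁ T₂ h f₁ f₂ f₃ = 0 := by
  have hp : Measurable fun p : (X × X) × (X × X) => p.1.1 := measurable_fst.comp measurable_fst
  rw [boxForm_eq_integral_fst]
  refine integral_comp_mul_eq_zero hp ((h₁.tensor_three h₂ h₃).integrable _) hm hgen hpi huniv
    (fun s hs => ?_) hh hb
  have hsm : MeasurableSet s := hm _ (hgen ▸ MeasurableSpace.measurableSet_generateFrom hs)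
  rw [← h0 s hs, boxForm_eq_integral_fst, ← integral_indicator (hp hsm)]
  refine integral_congr_ae (Eventually.of_forall fun p => ?_)
  by_cases hx : p.1.1 ∈ s <;> simp [Set.indicator, hx]

/-- The intersections of a `T₁`-invariant with a `T₂`-invariant set form a π-system generating
`I(T₁) ∨ I(T₂)`, which reduces the claim to `IsSystem.boxForm_indicator_inter_eq_zero`. -/
theorem IsSystem.boxForm_eq_zero_of_measurable (h : IsSystem ν T₁ T₂) {φ : X → ℝ}
    (hφ : IsBddMeasurable φ)
    (h0 : ν[φ | MeasurableSpace.invariants T₁ ⊔ MeasurableSpace.invariants T₂] =ᵐ[ν] 0)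
    {f : X → ℝ}
    (hf : Measurable[MeasurableSpace.invariants T₁ ⊔ MeasurableSpace.invariants T₂] f)
    (hb : ∃ C : ℝ, ∀ x, |f x| ≤ C) :
    boxForm ν T₁ T₂ f φ φ φ = 0 := by
  let 𝒞 : Set (Set X) := {s | ∃ A B, MeasurableSet[MeasurableSpace.invariants T₁] A ∧
    MeasurableSet[MeasurableSpace.invariants T₂] B ∧ s = A ∩ B}
  refine boxForm_eq_zero_of_generateFrom (𝒞 := 𝒞)
    (sup_le (MeasurableSpace.invariants_le T₁) (MeasurableSpace.invariants_le T₂)) ?_ ?_ ?_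
    hφ hφ hφ ?_ hf hb
  · refine le_antisymm (sup_le ?_ ?_) (MeasurableSpace.generateFrom_le ?_)
    · exact fun A hA => MeasurableSpace.measurableSet_generateFrom
        ⟨A, Set.univ, hA, .univ, (Set.inter_univ A).symm⟩
    · exact fun B hB => MeasurableSpace.measurableSet_generateFrom
        ⟨Set.univ, B, .univ, hB, (Set.univ_inter B).symm⟩
    · rintro _ ⟨A, B, hA, hB, rfl⟩
      exact MeasurableSet.inter
        ((le_sup_left : _ ≤ MeasurableSpace.invariants T₁ ⊔ MeasurableSpace.invariants T₂) _ hA)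
        ((le_sup_right : _ ≤ MeasurableSpace.invariants T₁ ⊔ MeasurableSpace.invariants T₂) _ hB)
  · rintro _ ⟨A, B, hA, hB, rfl⟩ _ ⟨A', B', hA', hB', rfl⟩ _
    exact ⟨A ∩ A', B ∩ B', hA.inter hA', hB.inter hB', Set.inter_inter_inter_comm A B A' B'⟩
  · exact ⟨Set.univ, Set.univ, .univ, .univ, (Set.univ_inter _).symm⟩
  · rintro _ ⟨A, B, hA, hB, rfl⟩
    exact h.boxForm_indicator_inter_eq_zero hφ h0 hA hB

/-- A system is magic if, for every set of a generating π-system, its indicator differs from a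
bounded `I(T₁) ∨ I(T₂)`-measurable function by a function of zero seminorm. -/
theorem IsSystem.isMagicSystem_of_generateFrom (h : IsSystem ν T₁ T₂) {𝒞 : Set (Set X)}
    (hgen : mX = MeasurableSpace.generateFrom 𝒞) (hpi : IsPiSystem 𝒞) (huniv : Set.univ ∈ 𝒞)
    {e : Set X → X → ℝ}
    (he : ∀ s ∈ 𝒞,
      Measurable[MeasurableSpace.invariants T₁ ⊔ MeasurableSpace.invariants T₂] (e s))
    (hb : ∀ s ∈ 𝒞, ∃ C : ℝ, ∀ x, |e s x| ≤ C)
    (h0 : ∀ s ∈ 𝒞, ∀ g : X → ℝ, g = (fun x => s.indicator 1 x - e s x) →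
      boxForm ν T₁ T₂ g g g g = 0) :
    IsMagicSystem ν T₁ T₂ where
  toIsSystem := h
  boxSeminorm_eq_zero φ hφm hφb hφ0 := by
    have hφ : IsBddMeasurable φ := ⟨hφm, hφb⟩
    rw [boxSeminorm_eq_zero_iff hφ]
    -- Only the first entry varies, with the other three frozen at `φ`; it ranges over all bounded
    -- measurable functions, `φ` included.
    refine boxForm_eq_zero_of_generateFrom le_rfl hgen hpi huniv hφ hφ hφ (fun s hs => ?_)
      hφm hφb
    have hsm : MeasurableSet s := by
      rw [hgen]
      exact MeasurableSpace.measurableSet_generateFrom hs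
    have hes : IsBddMeasurable (e s) := ⟨(he s hs).mono
      (sup_le (MeasurableSpace.invariants_le T₁) (MeasurableSpace.invariants_le T₂)) le_rfl,
      hb s hs⟩
    have h1 := boxForm_sub_left (ν := ν) (T₁ := T₁) (T₂ := T₂) (.indicator hsm) hes hφ hφ hφ
    rw [h.boxForm_eq_zero_of_self ((IsBddMeasurable.indicator hsm).sub hes) hφ (h0 s hs _ rfl),
      h.boxForm_eq_zero_of_measurable hφ hφ0 (he s hs) (hb s hs), sub_zero] at h1
    exact h1.symm

end BoxVanishing

theorem invariants_inf_le {X : Type*} [mX : MeasurableSpace X] {T₁ T₂ : X ≃ᵐ X} :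
    MeasurableSpace.invariants T₁ ⊓ MeasurableSpace.invariants T₂ ≤ mX :=
  inf_le_left.trans (MeasurableSpace.invariants_le T₁)

theorem abs_integral_le_of_forall_abs_le {X : Type*} [MeasurableSpace X] {ν : Measure X}
    [IsProbabilityMeasure ν] {k : X → ℝ} {C : ℝ} (hC : ∀ x, |k x| ≤ C) : |∫ x, k x ∂ν| ≤ C := by
  simpa using norm_integral_le_of_norm_le_const (μ := ν) (f := k) (Eventually.of_forall hC)

/-! ### Ergodic components and the disintegration of the seminorm -/

section ErgodicDecomposition

variable {X : Type*} {m : MeasurableSpace X} [mX : MeasurableSpace X] [StandardBorelSpace X]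
  {μ : Measure X} [IsFiniteMeasure μ] {T₁ T₂ : X ≃ᵐ X}

theorem integral_integral_ergodicComponent {k : X → ℝ} (hk : Integrable k μ) :
    ∫ x, ∫ y, k y ∂(ergodicComponent μ T₁ T₂ x) ∂μ = ∫ x, k x ∂μ := by
  rw [← integral_condExp (invariants_inf_le (T₁ := T₁) (T₂ := T₂)) (f := k)]
  exact integral_congr_ae (condExp_ae_eq_integral_condExpKernel invariants_inf_le hk).symm

theorem exists_countable_piSystem_generateFrom (X : Type*) [mX : MeasurableSpace X]
    [StandardBorelSpace X] : ∃ 𝒞 : Set (Set X), 𝒞.Countable ∧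
      mX = MeasurableSpace.generateFrom 𝒞 ∧ IsPiSystem 𝒞 ∧ Set.univ ∈ 𝒞 := by
  refine ⟨generateSetAlgebra (MeasurableSpace.countableGeneratingSet X),
    countable_generateSetAlgebra MeasurableSpace.countable_countableGeneratingSet, ?_, ?_, ?_⟩
  · rw [generateFrom_generateSetAlgebra_eq, MeasurableSpace.generateFrom_countableGeneratingSet]
  · exact fun s hs t ht _ => isSetAlgebra_generateSetAlgebra.inter_mem hs ht
  · exact isSetAlgebra_generateSetAlgebra.univ_mem

/-- Conditioning on `T`-invariant sets does not distinguish `s` from `T ⁻¹' s`. A countable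
generating π-system provides one null set that serves for all `s`. -/
theorem ae_measurePreserving_ergodicComponent {T : X ≃ᵐ X} (hT : MeasurePreserving T μ μ)
    (hle : MeasurableSpace.invariants T₁ ⊓ MeasurableSpace.invariants T₂
      ≤ MeasurableSpace.invariants T) :
    ∀ᵐ x ∂μ, MeasurePreserving T (ergodicComponent μ T₁ T₂ x) (ergodicComponent μ T₁ T₂ x) := by
  obtain ⟨𝒞, hcount, hgen, hpi, huniv⟩ := exists_countable_piSystem_generateFrom X
  have hmeas : ∀ s ∈ 𝒞, MeasurableSet s := fun s hs => by
    rw [hgen]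
    exact MeasurableSpace.measurableSet_generateFrom hs
  have hall : ∀ᵐ x ∂μ, ∀ s ∈ 𝒞, ergodicComponent μ T₁ T₂ x (T ⁻¹' s) =
      ergodicComponent μ T₁ T₂ x s := by
    refine (ae_ball_iff hcount).2 fun s hs => ?_
    filter_upwards [condExpKernel_ae_eq_condExp (μ := μ) (invariants_inf_le (T₁ := T₁) (T₂ := T₂))
        (T.measurable (hmeas s hs)),
      condExpKernel_ae_eq_condExp (μ := μ) (invariants_inf_le (T₁ := T₁) (T₂ := T₂)) (hmeas s hs),
      condExp_comp_of_le_invariants hT hle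
        ((IsBddMeasurable.indicator (hmeas s hs)).integrable μ)] with x h1 h2 h3
    rw [← measureReal_eq_measureReal_iff]
    exact h1.trans (h3.trans h2.symm)
  filter_upwards [hall] with x hx
  refine ⟨T.measurable, ext_of_generate_finite 𝒞 hgen hpi (fun s hs => ?_) ?_⟩
  · rw [Measure.map_apply T.measurable (hmeas s hs), hx s hs]
  · rw [Measure.map_apply T.measurable .univ, Set.preimage_univ]

theorem IsSystem.ae_ergodicComponent (h : IsSystem μ T₁ T₂) :
    ∀ᵐ x ∂μ, IsSystem (ergodicComponent μ T₁ T₂ x) T₁ T₂ := by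
  filter_upwards [ae_measurePreserving_ergodicComponent h.measurePreserving_fst inf_le_left,
    ae_measurePreserving_ergodicComponent h.measurePreserving_snd inf_le_right] with x h1 h2
  exact ⟨inferInstance, h1, h2, h.commute⟩

/-- The fourth power of the box seminorm is the average of its values on the ergodic
components. -/
theorem IsSystem.integral_boxForm_ergodicComponent (h : IsSystem μ T₁ T₂) {f : X → ℝ}
    (hf : IsBddMeasurable f) :
    Integrable (fun x => boxForm (ergodicComponent μ T₁ T₂ x) T₁ T₂ f f f f) μ ∧
      ∫ x, boxForm (ergodicComponent μ T₁ T₂ x) T₁ T₂ f f f f ∂μ = boxForm μ T₁ T₂ f f f f := by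
  obtain ⟨C, hC⟩ := hf.2
  let k : ℕ → ℕ → X → ℝ := fun n j x =>
    (f x * f (T₂^[n] x)) * (f (T₁^[j] x) * f (T₂^[n] (T₁^[j] x)))
  have hk : ∀ n j, IsBddMeasurable (k n j) := fun n j =>
    (hf.mul (hf.comp (T₂.measurable.iterate n))).mul
      ((hf.comp (T₁.measurable.iterate j)).mul
        (hf.comp ((T₂.measurable.iterate n).comp (T₁.measurable.iterate j))))
  have hkC : ∀ n j x, |k n j x| ≤ (C * C) * (C * C) := fun n j x => by
    have h2 : ∀ y z, |f y * f z| ≤ C * C := fun y z => by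
      rw [abs_mul]
      exact mul_le_mul (hC y) (hC z) (abs_nonneg _) ((abs_nonneg _).trans (hC y))
    rw [abs_mul]
    exact mul_le_mul (h2 _ _) (h2 _ _) (abs_nonneg _) ((abs_nonneg _).trans (h2 x x))
  -- Inner limit, along `T₁`: it also supplies the measurability and the uniform bound in `x` that
  -- the outer limit needs.
  have hcorr : ∀ n, _ := fun n => tendsto_average_integral (ν := μ)
    (v := fun j x => ∫ y, k n j y ∂(ergodicComponent μ T₁ T₂ x))
    (w := fun x => boxCorrelation (ergodicComponent μ T₁ T₂ x) T₁ T₂ f f f f n)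
    (C := (C * C) * (C * C))
    (fun j => (hk n j).1.aestronglyMeasurable.integral_condExpKernel)
    (fun j => Eventually.of_forall fun x => abs_integral_le_of_forall_abs_le (hkC n j))
    (h.ae_ergodicComponent.mono fun x hx => hx.tendsto_boxCorrelation hf hf hf hf n)
  have hcorr' : ∀ n, ∫ x, boxCorrelation (ergodicComponent μ T₁ T₂ x) T₁ T₂ f f f f n ∂μ =
      boxCorrelation μ T₁ T₂ f f f f n := by
    intro n
    refine tendsto_nhds_unique (hcorr n).2.2 ?_
    simp only [fun j => integral_integral_ergodicComponent (T₁ := T₁) (T₂ := T₂)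
      ((hk n j).integrable μ)]
    exact h.tendsto_boxCorrelation hf hf hf hf n
  -- Outer limit, along `T₂`, with the same bound.
  obtain ⟨h1, h2, h3⟩ := tendsto_average_integral (ν := μ)
    (w := fun x => boxForm (ergodicComponent μ T₁ T₂ x) T₁ T₂ f f f f)
    (fun n => (hcorr n).1) (fun n => (hcorr n).2.1)
    (h.ae_ergodicComponent.mono fun x hx => hx.tendsto_boxForm hf hf hf hf)
  refine ⟨memLp_one_iff_integrable.1 (MemLp.of_bound h1 _ h2), tendsto_nhds_unique h3 ?_⟩
  simp only [hcorr']
  exact h.tendsto_boxForm hf hf hf hf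

theorem IsSystem.ae_boxForm_ergodicComponent_eq_zero (h : IsSystem μ T₁ T₂) {f : X → ℝ}
    (hf : IsBddMeasurable f) (h0 : boxForm μ T₁ T₂ f f f f = 0) :
    ∀ᵐ x ∂μ, boxForm (ergodicComponent μ T₁ T₂ x) T₁ T₂ f f f f = 0 := by
  obtain ⟨hint, heq⟩ := h.integral_boxForm_ergodicComponent hf
  exact (integral_eq_zero_iff_of_nonneg (fun x => boxForm_self_nonneg hf) hint).1 (heq.trans h0)

end ErgodicDecomposition

/-! ### Almost every ergodic component is magic -/

/-- The conditional expectation of an indicator has a version with values in `[0, 1]`. -/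
theorem exists_measurable_condExp_indicator {X : Type*} {m : MeasurableSpace X}
    [mX : MeasurableSpace X] {μ : Measure X} [IsFiniteMeasure μ] (hm : m ≤ mX) {s : Set X}
    (hs : MeasurableSet s) :
    ∃ e : X → ℝ, Measurable[m] e ∧ (∀ x, |e x| ≤ 1) ∧
      μ[s.indicator (1 : X → ℝ) | m] =ᵐ[μ] e := by
  -- Truncation makes the bound hold everywhere, so it survives the passage from `μ` to its
  -- components.
  refine ⟨fun x => max 0 (min 1 ((μ[s.indicator (1 : X → ℝ) | m]) x)), ?_, ?_, ?_⟩
  · exact measurable_const.max (measurable_const.min stronglyMeasurable_condExp.measurable)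
  · intro x
    rw [abs_of_nonneg (le_max_left _ _)]
    exact max_le zero_le_one (min_le_left _ _)
  · have hi : Integrable (s.indicator (1 : X → ℝ)) μ := (IsBddMeasurable.indicator hs).integrable μ
    have h0 : 0 ≤ᵐ[μ] μ[s.indicator (1 : X → ℝ) | m] :=
      condExp_nonneg (Eventually.of_forall fun x => Set.indicator_nonneg (by simp) x)
    have h1 := condExp_mono (m := m) hi (integrable_const (1 : ℝ))
      (Eventually.of_forall fun x => Set.indicator_le_self' (by simp) x)
    rw [condExp_const hm] at h1
    filter_upwards [h0, h1] with x hx hx'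
    rw [min_eq_right hx']
    exact (max_eq_right hx).symm

theorem proposition3 {X : Type*} [MeasurableSpace X] [StandardBorelSpace X]
    (μ : Measure X) [IsProbabilityMeasure μ] (T₁ T₂ : X ≃ᵐ X) (h : IsMagicSystem μ T₁ T₂) :
    ∀ᵐ x ∂μ, IsMagicSystem (ergodicComponent μ T₁ T₂ x) T₁ T₂ := by
  obtain ⟨𝒞, hcount, hgen, hpi, huniv⟩ := exists_countable_piSystem_generateFrom X
  have hmeas : ∀ s ∈ 𝒞, MeasurableSet s := fun s hs => by
    rw [hgen]
    exact MeasurableSpace.measurableSet_generateFrom hs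
  have hZ := sup_le (MeasurableSpace.invariants_le T₁) (MeasurableSpace.invariants_le T₂)
  -- The versions are chosen once, for `μ`, before any component is fixed; outside `𝒞` the value `0`
  -- is a dummy.
  have hex : ∀ s : Set X, ∃ e : X → ℝ, s ∈ 𝒞 →
      Measurable[MeasurableSpace.invariants T₁ ⊔ MeasurableSpace.invariants T₂] e ∧
      (∀ x, |e x| ≤ 1) ∧ μ[s.indicator (1 : X → ℝ) |
        MeasurableSpace.invariants T₁ ⊔ MeasurableSpace.invariants T₂] =ᵐ[μ] e := by
    intro s
    by_cases hs : s ∈ 𝒞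
    · obtain ⟨e, he⟩ := exists_measurable_condExp_indicator (μ := μ) hZ (hmeas s hs)
      exact ⟨e, fun _ => he⟩
    · exact ⟨0, fun h => absurd h hs⟩
  choose e he using hex
  have hae : ∀ᵐ x ∂μ, ∀ s ∈ 𝒞, ∀ g : X → ℝ, g = (fun x => s.indicator 1 x - e s x) →
      boxForm (ergodicComponent μ T₁ T₂ x) T₁ T₂ g g g g = 0 := by
    refine (ae_ball_iff hcount).2 fun s hs => ?_
    obtain ⟨hem, heb, hec⟩ := he s hs
    have hes : IsBddMeasurable (e s) := ⟨hem.mono hZ le_rfl, 1, heb⟩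
    have hind : IsBddMeasurable (s.indicator (1 : X → ℝ)) := .indicator (hmeas s hs)
    have hg := hind.sub hes
    have hg0 : μ[fun x => s.indicator 1 x - e s x |
        MeasurableSpace.invariants T₁ ⊔ MeasurableSpace.invariants T₂] =ᵐ[μ] 0 := by
      refine (condExp_sub (hind.integrable μ) (hes.integrable μ) _).trans ?_
      rw [condExp_of_stronglyMeasurable hZ hem.stronglyMeasurable (hes.integrable μ)]
      filter_upwards [hec] with x hx
      simp [hx]
    have hbox := (boxSeminorm_eq_zero_iff hg).1 (h.boxSeminorm_eq_zero _ hg.1 hg.2 hg0)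
    filter_upwards [h.toIsSystem.ae_boxForm_ergodicComponent_eq_zero hg hbox] with x hx g hgx
    rw [hgx]
    exact hx
  filter_upwards [h.toIsSystem.ae_ergodicComponent, hae] with x hx hx0
  exact hx.isMagicSystem_of_generateFrom hgen hpi huniv (fun s hs => (he s hs).1)
    (fun s hs => ⟨1, (he s hs).2.1⟩) hx0
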